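/- Write $v\wedge w=v_1w_2-v_2w_1$ for $v,w\in\mathbb R^2$. Let $\mathcal C\subset\mathbb R^2$ be an embedded convex curve (that is, $\mathcal C$ lies on the boundary of its convex hull; it may be closed) which has a $C^3$ parametrization $c\colon I\to\mathcal C$ by affine arc length, $c'\wedge c''\equiv 1$, on a bounded interval $I$ of positive length. Its affine length is $\Lambda(\mathcal C)=\int_I (c'\wedge c'')^{1/3}\,ds$ and its affine curvature $\kappa$ is defined by $c'''=-\kappa c'$. Let $k_0,k_1$ be constants with $k_0\le\kappa\le k_1$ on $\mathcal C$. Let $v_0,v_1,v_2\in\mathbb R^2$ with $v_1,v_2$ linearly independent, $\mathcal L=\{v_0+mv_1+nv_2: m,n\in\mathbb Z\}$ and $A_{\mathcal L}=|v_1\wedge v_2|$. If $\mathcal L\cap\mathcal C$ has at least three points, let $\mathfrak m=\mathfrak m(\mathcal C,\mathcal L)$ be the largest positive integer such that $\operatorname{Area}(\triangle p_1p_2p_3)\ge \frac{\mathfrak m}{2}A_{\mathcal L}$ for all distinct $p_1,p_2,p_3\in\mathcal L\cap\mathcal C$. For $k\in\mathbb R$ let $\bar x_k,\bar y_k$ be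 the solutions of $$\bar x_k'''+k\bar x_k'=0,\quad \bar x_k(0)=0,\ \bar x_k'(0)=1,\ \bar x_k''(0)=0,\qquad \bar y_k'''+k\bar y_k'=0,\quad \bar y_k(0)=0,\ \bar y_k'(0)=0,\ \bar y_k''(0)=1,$$ and let $G_k\colon J_k\to I_k$ be the inverse of $H_k\colon I_k\to J_k$, $H_k(s)=\bar x_k(s)\bar y_k(s)$, where $I_k=J_k=[0,\infty)$ if $k\le0$, and $I_k=[0,\pi/(2\sqrt k)]$, $J_k=[0,k^{-3/2}]$ if $k>0$. Assume that $\mathcal L\cap\mathcal C$ has at least three points (so that $\mathfrak m$ is defined) and that $\mathfrak mA_{\mathcal L}/2\in J_{k_0}$ (which is automatic if $k_0\le 0$). Set $L=G_{k_0}(\mathfrak mA_{\mathcal L}/2)$ and $m=\lfloor\Lambda(\mathcal C)/(2L)\rfloor$, and if $k_1>0$ assume also that $k_1\le(\pi/(2L))^2$. Then $$\#(\mathcal L\cap\mathcal C)\le 2m+2.$$ -/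

import Mathlib

open Set MeasureTheory

noncomputable section

/-- The plane `ℝ²`. -/
abbrev Plane : Type := EuclideanSpace ℝ (Fin 2)

/-- `v ∧ w = v₁ w₂ - v₂ w₁`. -/
def wedge (v w : Plane) : ℝ := v 0 * w 1 - v 1 * w 0

/-- The affine length `∫_I (c' ∧ c'')^{1/3} dt` of a curve `c` on the interval `I`.
Derivatives are taken within `I`, so they are one-sided at the end points of `I` that
belong to `I`. -/
def affineLength (c : ℝ → Plane) (I : Set ℝ) : ℝ :=
  ∫ t in I, (wedge (iteratedDerivWithin 1 c I t) (iteratedDerivWithin 2 c I t)) ^ (1 / 3 : ℝ)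

/-- `c`, restricted to the interval `I`, is a parametrization by affine arc length of the
embedded plane curve `C`, three times continuously differentiable up to the end points that
belong to `I`.  The interval may be open, half-open or closed; if it is closed, then the images
of its two end points may coincide (closed curves), and `c` is injective otherwise. -/
structure IsAffineParametrization (c : ℝ → Plane) (I : Set ℝ) (C : Set Plane) : Prop where
  ordConnected : I.OrdConnected
  interior_nonempty : (interior I).Nonempty
  contDiffOn : ContDiffOn ℝ 3 c I
  unit_speed : ∀ s ∈ I, wedge (iteratedDerivWithin 1 c I s) (iteratedDerivWithin 2 c I s) = 1
  simple : ∀ s ∈ I, ∀ t ∈ I, s < t → c s = c t → IsLeast I s ∧ IsGreatest I t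
  image_eq : c '' I = C

/-- A curve is convex if it lies on the boundary of its convex hull. -/
def IsConvexCurve (C : Set Plane) : Prop := C ⊆ frontier (convexHull ℝ C)

/-- The affine curvature `κ` of a curve parametrized by affine arc length.  It is characterized by
`c''' = -κ c'`, see `affineCurvature_spec` and `eq_affineCurvature`. -/
def affineCurvature (c : ℝ → Plane) (I : Set ℝ) (s : ℝ) : ℝ :=
  wedge (iteratedDerivWithin 2 c I s) (iteratedDerivWithin 3 c I s)

theorem eq_affineCurvature {c : ℝ → Plane} {I : Set ℝ} {C : Set Plane}
    (hc : IsAffineParametrization c I C) {s : ℝ} (hs : s ∈ I) {k : ℝ}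
    (hk : iteratedDerivWithin 3 c I s = -(k • iteratedDerivWithin 1 c I s)) :
    k = affineCurvature c I s := by
  have h := hc.unit_speed s hs
  simp only [affineCurvature, hk, wedge, PiLp.neg_apply, PiLp.smul_apply, smul_eq_mul] at h ⊢
  linear_combination (-k) * h

theorem affineCurvature_spec {c : ℝ → Plane} {I : Set ℝ} {C : Set Plane}
    (hc : IsAffineParametrization c I C) {s : ℝ} (hs : s ∈ I) :
    iteratedDerivWithin 3 c I s = -(affineCurvature c I s • iteratedDerivWithin 1 c I s) := by
  have hu : UniqueDiffOn ℝ I := uniqueDiffOn_convex hc.ordConnected.convex hc.interior_nonempty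
  have hd : ∀ n : ℕ, n < 3 → HasDerivWithinAt (iteratedDerivWithin n c I)
      (iteratedDerivWithin (n + 1) c I s) I s := by
    intro n hn
    rw [iteratedDerivWithin_succ]
    exact (hc.contDiffOn.differentiableOn_iteratedDerivWithin
      (by exact_mod_cast hn) hu s hs).hasDerivWithinAt
  have hp : ∀ n : ℕ, n < 3 → ∀ i : Fin 2,
      HasDerivWithinAt (fun t => iteratedDerivWithin n c I t i)
        (iteratedDerivWithin (n + 1) c I s i) I s := by
    intro n hn i
    exact (EuclideanSpace.proj (𝕜 := ℝ) (ι := Fin 2) i).hasFDerivAt.comp_hasDerivWithinAt s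
      (hd n hn)
  have h1 := ((hp 1 (by norm_num) 0).mul (hp 2 (by norm_num) 1)).sub
    ((hp 1 (by norm_num) 1).mul (hp 2 (by norm_num) 0))
  have h2 : HasDerivWithinAt (fun _ : ℝ => (1 : ℝ)) 0 I s := hasDerivWithinAt_const _ _ _
  have h3 := h2.congr (f₁ := fun t => wedge (iteratedDerivWithin 1 c I t)
    (iteratedDerivWithin 2 c I t)) hc.unit_speed (hc.unit_speed s hs)
  have h4 := (hu s hs).eq_deriv I h1 h3
  have h := hc.unit_speed s hs
  simp only [affineCurvature, wedge] at h h4 ⊢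
  norm_num only [Nat.reduceAdd] at h4
  ext i
  simp only [PiLp.neg_apply, PiLp.smul_apply, smul_eq_mul]
  fin_cases i
  · simp only [Fin.zero_eta]
    linear_combination (iteratedDerivWithin 3 c I s 0) * (-h) + iteratedDerivWithin 2 c I s 0 * h4
  · simp only [Fin.mk_one]
    linear_combination (iteratedDerivWithin 3 c I s 1) * (-h) + iteratedDerivWithin 2 c I s 1 * h4

/-- The lattice with origin `v₀` generated by `v₁` and `v₂`. -/
def planeLattice (v₀ v₁ v₂ : Plane) : Set Plane :=
  {p | ∃ m n : ℤ, p = v₀ + (m : ℝ) • v₁ + (n : ℝ) • v₂}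

/-- The area `|v₁ ∧ v₂|` of a fundamental domain of `planeLattice v₀ v₁ v₂`. -/
def latticeArea (v₁ v₂ : Plane) : ℝ := |wedge v₁ v₂|

/-- The area of the triangle with vertices `p₁`, `p₂`, `p₃`. -/
def triangleArea (p₁ p₂ p₃ : Plane) : ℝ := |wedge (p₂ - p₁) (p₃ - p₁)| / 2

/-- `𝔪(C, 𝓛)` for `𝓛 = planeLattice v₀ v₁ v₂`: the largest positive integer `n` such that every
triangle with distinct vertices in `𝓛 ∩ C` has area at least `n A_𝓛 / 2`.  The value is `0` if
there is no largest one, in particular if `𝓛 ∩ C` has fewer than three points. -/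
def areaMultiplicity (C : Set Plane) (v₀ v₁ v₂ : Plane) : ℕ :=
  sSup {n : ℕ | 0 < n ∧ ∀ p₁ ∈ planeLattice v₀ v₁ v₂ ∩ C, ∀ p₂ ∈ planeLattice v₀ v₁ v₂ ∩ C,
    ∀ p₃ ∈ planeLattice v₀ v₁ v₂ ∩ C, p₁ ≠ p₂ → p₁ ≠ p₃ → p₂ ≠ p₃ →
      (n : ℝ) / 2 * latticeArea v₁ v₂ ≤ triangleArea p₁ p₂ p₃}

/-- The solution `𝐬_k` of `u'' + k u = 0`, `u(0) = 0`, `u'(0) = 1`. -/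
def sinK (k s : ℝ) : ℝ :=
  if 0 < k then Real.sin (√k * s) / √k
  else if k = 0 then s
  else Real.sinh (√|k| * s) / √|k|

/-- The solution `𝐜_k` of `u'' + k u = 0`, `u(0) = 1`, `u'(0) = 0`. -/
def cosK (k s : ℝ) : ℝ :=
  if 0 < k then Real.cos (√k * s)
  else if k = 0 then 1
  else Real.cosh (√|k| * s)

/-- The solution `x̄_k` of `x''' + k x' = 0`, `x(0) = 0`, `x'(0) = 1`, `x''(0) = 0`. -/
def xBar (k s : ℝ) : ℝ := sinK k s

/-- The solution `ȳ_k` of `y''' + k y' = 0`, `y(0) = 0`, `y'(0) = 0`, `y''(0) = 1`. -/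
def yBar (k s : ℝ) : ℝ := if k = 0 then s ^ 2 / 2 else (1 - cosK k s) / k

/-- `H_k = x̄_k ȳ_k`. -/
def areaFun (k s : ℝ) : ℝ := xBar k s * yBar k s

/-- The interval on which `H_k` is inverted: `[0, ∞)` if `k ≤ 0`, and `[0, π / (2 √k)]` if
`k > 0`. -/
def areaFunDomain (k : ℝ) : Set ℝ :=
  if k ≤ 0 then Ici 0 else Icc 0 (Real.pi / (2 * √k))

/-- The image of `areaFunDomain k` under `H_k`: `[0, ∞)` if `k ≤ 0`, and `[0, k^{-3/2}]` if
`k > 0`. -/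
def areaFunRange (k : ℝ) : Set ℝ :=
  if k ≤ 0 then Ici 0 else Icc 0 (1 / k ^ (3 / 2 : ℝ))

/-- The inverse `G_k` of `H_k : areaFunDomain k → areaFunRange k` (meaningful on
`areaFunRange k`). -/
def areaFunInv (k : ℝ) : ℝ → ℝ := Function.invFunOn (areaFun k) (areaFunDomain k)

end

/-! Three distinct points of `𝓛 ∩ C` span a triangle of area at least `𝔪 A / 2 = H_{k₀}(L)`. The
claim follows once three curve points with parameters pairwise less than `2L` apart are shown to
span a smaller area: the parameters lie in `m + 1` half-open cells of length `2L`, and each cell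
then holds at most two points.

For `a ≤ b ≤ d` twice the area of the inscribed triangle is the integral of `c'(s) ∧ c'(t)` over `s
∈ [a, b]`, `t ∈ [b, d]`. For fixed `s` the integrand solves `S'' = -κ S`, `S(s) = 0`, `S'(s) = 1`.
Sturm comparison with `κ ≤ (π / (2L))²` makes it nonnegative for `t - s < 2L`, and comparison with
`k₀ ≤ κ` bounds it by `sinK k₀ (t - s)`. Integrating twice bounds the area by that of a triangle on
an arc of constant curvature `k₀`, which is largest with the middle vertex halfway: `H_{k₀}((d - a)
/ 2) < H_{k₀}(L)`. This is `wedge_chords_mem_Icc`.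

Convexity serves only to exclude collinear triples (`wedge_sub_ne_zero`). Lattice triangles on `C`
then have area at least `A / 2`, so `𝔪` is a genuine positive maximum. -/

lemma monotoneOn_Icc_of_hasDerivWithinAt {f f' : ℝ → ℝ} {a b : ℝ}
    (hf : ∀ t ∈ Icc a b, HasDerivWithinAt f (f' t) (Icc a b) t)
    (h0 : ∀ t ∈ Icc a b, 0 ≤ f' t) : MonotoneOn f (Icc a b) :=
  monotoneOn_of_hasDerivWithinAt_nonneg (convex_Icc a b)
    (fun t ht => (hf t ht).continuousWithinAt)
    (fun t ht => (hf t (interior_subset ht)).mono interior_subset)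
    (fun t ht => h0 t (interior_subset ht))

lemma antitoneOn_Icc_of_hasDerivWithinAt {f f' : ℝ → ℝ} {a b : ℝ}
    (hf : ∀ t ∈ Icc a b, HasDerivWithinAt f (f' t) (Icc a b) t)
    (h0 : ∀ t ∈ Icc a b, f' t ≤ 0) : AntitoneOn f (Icc a b) :=
  antitoneOn_of_hasDerivWithinAt_nonpos (convex_Icc a b)
    (fun t ht => (hf t ht).continuousWithinAt)
    (fun t ht => (hf t (interior_subset ht)).mono interior_subset)
    (fun t ht => h0 t (interior_subset ht))

/-! ### Model functions of constant affine curvature -/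

lemma hasDerivAt_sinK (k s : ℝ) : HasDerivAt (sinK k) (cosK k s) s := by
  have hlin (r : ℝ) : HasDerivAt (fun s : ℝ => r * s) r s := by
    simpa using (hasDerivAt_id s).const_mul r
  unfold sinK cosK
  rcases lt_trichotomy 0 k with h | h | h
  · have : √k ≠ 0 := (Real.sqrt_pos.2 h).ne'
    simp only [h, if_true]
    exact ((hlin √k).sin.div_const √k).congr_deriv (by field_simp)
  · subst h
    simpa using hasDerivAt_id' s
  · have : √|k| ≠ 0 := (Real.sqrt_pos.2 (abs_pos.2 h.ne)).ne'
    simp only [h.not_gt, h.ne, if_false]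
    exact ((hlin √|k|).sinh.div_const √|k|).congr_deriv (by field_simp)

lemma hasDerivAt_cosK (k s : ℝ) : HasDerivAt (cosK k) (-(k * sinK k s)) s := by
  have hlin (r : ℝ) : HasDerivAt (fun s : ℝ => r * s) r s := by
    simpa using (hasDerivAt_id s).const_mul r
  unfold sinK cosK
  rcases lt_trichotomy 0 k with h | h | h
  · have h1 : √k ≠ 0 := (Real.sqrt_pos.2 h).ne'
    have h2 : √k ^ 2 = k := Real.sq_sqrt h.le
    simp only [h, if_true]
    convert (hlin √k).cos using 1
    field_simp
    rw [h2]
  · subst h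
    simpa using hasDerivAt_const s (1 : ℝ)
  · have h1 : √|k| ≠ 0 := (Real.sqrt_pos.2 (abs_pos.2 h.ne)).ne'
    have h2 : √|k| ^ 2 = -k := by rw [Real.sq_sqrt (abs_nonneg k), abs_of_neg h]
    simp only [h.not_gt, h.ne, if_false]
    convert (hlin √|k|).cosh using 1
    field_simp
    rw [h2]
    ring

lemma hasDerivAt_yBar (k s : ℝ) : HasDerivAt (yBar k) (sinK k s) s := by
  unfold yBar
  by_cases h : k = 0
  · subst h
    simp only [if_true]
    exact (((hasDerivAt_id' s).pow 2).div_const 2).congr_deriv (by simp [sinK])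
  · simp only [h, if_false]
    exact (((hasDerivAt_cosK k s).const_sub 1).div_const k).congr_deriv (by field_simp)

@[simp] lemma sinK_zero (k : ℝ) : sinK k 0 = 0 := by simp [sinK]

@[simp] lemma cosK_zero (k : ℝ) : cosK k 0 = 1 := by simp [cosK]

@[simp] lemma yBar_zero (k : ℝ) : yBar k 0 = 0 := by simp [yBar]

lemma sinK_pos {k s : ℝ} (hs : 0 < s) (h : 0 < k → √k * s < Real.pi) : 0 < sinK k s := by
  unfold sinK
  split_ifs with h1 h2
  · have := Real.sqrt_pos.2 h1
    exact div_pos (Real.sin_pos_of_pos_of_lt_pi (by positivity) (h h1)) this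
  · exact hs
  · have := Real.sqrt_pos.2 (abs_pos.2 h2)
    exact div_pos (Real.sinh_pos_iff.2 (by positivity)) this

lemma sinK_nonneg {k s : ℝ} (hs : 0 ≤ s) (h : 0 < k → √k * s < Real.pi) : 0 ≤ sinK k s := by
  rcases hs.eq_or_lt with rfl | hs
  · simp
  · exact (sinK_pos hs h).le

lemma cosK_nonneg {k s : ℝ} (hs : 0 ≤ s) (h : 0 < k → √k * s ≤ Real.pi / 2) : 0 ≤ cosK k s := by
  unfold cosK
  split_ifs with h1 h2
  · have hpi := Real.pi_pos
    have h3 : 0 ≤ √k * s := by positivity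
    exact Real.cos_nonneg_of_mem_Icc ⟨by linarith, h h1⟩
  · exact zero_le_one
  · exact (Real.cosh_pos _).le

lemma sinK_two_mul (k s : ℝ) : sinK k (2 * s) = 2 * sinK k s * cosK k s := by
  unfold sinK cosK
  split_ifs with h1 h2
  · rw [mul_left_comm, Real.sin_two_mul]; ring
  · ring
  · rw [mul_left_comm, Real.sinh_two_mul]; ring

lemma yBar_nonneg (k s : ℝ) : 0 ≤ yBar k s := by
  unfold yBar cosK
  split_ifs with h1 h2
  · positivity
  · exact div_nonneg (sub_nonneg.2 (Real.cos_le_one _)) h2.le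
  · exact div_nonneg_of_nonpos (sub_nonpos.2 (Real.one_le_cosh _)) (not_lt.1 h2)

/-- The primitive of `yBar k` that vanishes at `0`. -/
noncomputable def yBarPrimitive (k s : ℝ) : ℝ := if k = 0 then s ^ 3 / 6 else (s - sinK k s) / k

@[simp] lemma yBarPrimitive_zero (k : ℝ) : yBarPrimitive k 0 = 0 := by simp [yBarPrimitive]

lemma hasDerivAt_yBarPrimitive (k s : ℝ) : HasDerivAt (yBarPrimitive k) (yBar k s) s := by
  unfold yBarPrimitive yBar
  by_cases h : k = 0
  · subst h
    simp only [if_true]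
    exact (((hasDerivAt_id' s).pow 3).div_const 6).congr_deriv (by simp; ring)
  · simp only [h, if_false]
    exact ((hasDerivAt_id s).sub (hasDerivAt_sinK k s)).div_const k

/-- The double angle formula identifies the twice integrated bound, taken at the midpoint, with `2
H_k`. -/
lemma yBarPrimitive_two_mul (k s : ℝ) :
    yBarPrimitive k (2 * s) - 2 * yBarPrimitive k s = 2 * areaFun k s := by
  unfold yBarPrimitive areaFun yBar xBar
  rw [sinK_two_mul]
  split_ifs with h
  · subst h; simp [sinK]; ring
  · field_simp; ring

lemma yBar_monotoneOn {k l : ℝ} (h : 0 < k → √k * l < Real.pi) :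
    MonotoneOn (yBar k) (Icc 0 l) :=
  monotoneOn_Icc_of_hasDerivWithinAt (fun t _ => (hasDerivAt_yBar k t).hasDerivWithinAt)
    fun _ ht => sinK_nonneg ht.1 fun hk =>
      (mul_le_mul_of_nonneg_left ht.2 (Real.sqrt_nonneg k)).trans_lt (h hk)

/-- Among the triangles inscribed in an arc of constant affine curvature that have two vertices at
the end points of the arc, the one with third vertex at the midpoint has the largest area. -/
lemma yBarPrimitive_sub_le {k p q : ℝ} (hp : 0 ≤ p) (hq : 0 ≤ q)
    (h : 0 < k → √k * (p + q) < Real.pi) :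
    yBarPrimitive k (p + q) - yBarPrimitive k p - yBarPrimitive k q ≤
      2 * areaFun k ((p + q) / 2) := by
  wlog hpq : p ≤ q generalizing p q
  · have := this hq hp (by rwa [add_comm]) (le_of_not_ge hpq)
    rw [add_comm q p] at this
    linarith
  -- With `p + q` fixed, let `x` be the offset of the vertex from the midpoint. Since `yBar k`
  -- increases, the primitive is convex, so the subtracted sum is smallest at `x = 0`; the offset
  -- `(q - p) / 2` gives back `p` and `q`.
  have hm := monotoneOn_Icc_of_hasDerivWithinAt (a := 0) (b := (q - p) / 2)
    (f := fun x => yBarPrimitive k ((p + q) / 2 + x) + yBarPrimitive k ((p + q) / 2 - x))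
    (f' := fun x => yBar k ((p + q) / 2 + x) - yBar k ((p + q) / 2 - x))
    (fun t _ => by
      have h1 := (hasDerivAt_yBarPrimitive k ((p + q) / 2 + t)).comp_const_add ((p + q) / 2) t
      have h2 := (hasDerivAt_yBarPrimitive k ((p + q) / 2 - t)).comp_const_sub ((p + q) / 2) t
      exact (h1.add h2).hasDerivWithinAt)
    (fun t ht => sub_nonneg.2 (yBar_monotoneOn h ⟨by linarith [ht.1, ht.2], by linarith [ht.1, ht.2]⟩
      ⟨by linarith [ht.1, ht.2], by linarith [ht.1, ht.2]⟩ (by linarith [ht.1])))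
  have := hm (left_mem_Icc.2 (by linarith)) (right_mem_Icc.2 (by linarith)) (by linarith)
  have h2 := yBarPrimitive_two_mul k ((p + q) / 2)
  simp only [add_zero, sub_zero] at this
  rw [show (p + q) / 2 + (q - p) / 2 = q by ring, show (p + q) / 2 - (q - p) / 2 = p by ring] at this
  rw [show 2 * ((p + q) / 2) = p + q by ring] at h2
  linarith

/-! ### The function `H_k` and its inverse -/

lemma mem_areaFunDomain {k s : ℝ} :
    s ∈ areaFunDomain k ↔ 0 ≤ s ∧ (0 < k → √k * s ≤ Real.pi / 2) := by
  unfold areaFunDomain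
  split_ifs with h
  · simp [h.not_gt]
  · have hk := Real.sqrt_pos.2 (not_le.1 h)
    simp only [mem_Icc, not_le.1 h, forall_const]
    rw [← div_div, le_div_iff₀ hk, mul_comm]

lemma convex_areaFunDomain (k : ℝ) : Convex ℝ (areaFunDomain k) := by
  unfold areaFunDomain
  split_ifs
  exacts [convex_Ici 0, convex_Icc _ _]

lemma hasDerivAt_areaFun (k s : ℝ) :
    HasDerivAt (areaFun k) (cosK k s * yBar k s + sinK k s * sinK k s) s :=
  (hasDerivAt_sinK k s).mul (hasDerivAt_yBar k s)

lemma continuous_areaFun (k : ℝ) : Continuous (areaFun k) :=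
  continuous_iff_continuousAt.2 fun s => (hasDerivAt_areaFun k s).continuousAt

/-- In `H_k' = cosK * yBar + sinK²` the first term is nonnegative because the domain stops at `π /
(2√k)` when `k > 0`, and the second is positive away from `0`. -/
lemma areaFun_strictMonoOn (k : ℝ) : StrictMonoOn (areaFun k) (areaFunDomain k) := by
  refine strictMonoOn_of_hasDerivWithinAt_pos (convex_areaFunDomain k)
    (continuous_areaFun k).continuousOn
    (fun s _ => (hasDerivAt_areaFun k s).hasDerivWithinAt) fun s hs => ?_
  have hs' := mem_areaFunDomain.1 (interior_subset hs)
  have hs0 : 0 < s := by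
    have : interior (areaFunDomain k) ⊆ Ioi 0 := by
      rw [← interior_Ici]
      exact interior_mono fun x hx => (mem_areaFunDomain.1 hx).1
    exact this hs
  have h1 := sinK_pos hs0 fun hk => (hs'.2 hk).trans_lt (by linarith [Real.pi_pos])
  have h2 := cosK_nonneg hs'.1 hs'.2
  have h3 := yBar_nonneg k s
  positivity

@[simp] lemma areaFun_zero (k : ℝ) : areaFun k 0 = 0 := by simp [areaFun, yBar_zero]

lemma le_sinK_of_nonpos {k s : ℝ} (hk : k ≤ 0) (hs : 0 ≤ s) : s ≤ sinK k s := by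
  unfold sinK
  rw [if_neg hk.not_gt]
  split_ifs with h
  · exact le_rfl
  · have := Real.sqrt_pos.2 (abs_pos.2 h)
    rw [le_div_iff₀ this, mul_comm]
    exact Real.self_le_sinh_iff.2 (by positivity)

lemma sq_div_two_le_yBar_of_nonpos {k s : ℝ} (hk : k ≤ 0) (hs : 0 ≤ s) :
    s ^ 2 / 2 ≤ yBar k s := by
  have hm := monotoneOn_Icc_of_hasDerivWithinAt (a := 0) (b := s)
    (f := fun x => yBar k x - x ^ 2 / 2) (f' := fun x => sinK k x - x)
    (fun t _ => by
      have h := (hasDerivAt_yBar k t).sub (((hasDerivAt_id t).pow 2).div_const 2)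
      simp at h
      exact h.hasDerivWithinAt)
    (fun t ht => sub_nonneg.2 (le_sinK_of_nonpos hk ht.1))
  have := hm (left_mem_Icc.2 hs) (right_mem_Icc.2 hs) hs
  simp at this
  exact this

lemma areaFun_pi_div {k : ℝ} (hk : 0 < k) :
    areaFun k (Real.pi / (2 * √k)) = 1 / k ^ (3 / 2 : ℝ) := by
  have h1 := Real.sqrt_pos.2 hk
  have h2 : √k * (Real.pi / (2 * √k)) = Real.pi / 2 := by field_simp
  have h3 : k ^ (3 / 2 : ℝ) = k * √k := by
    rw [Real.sqrt_eq_rpow, ← Real.rpow_one_add' hk.le (by norm_num)]; norm_num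
  simp only [areaFun, xBar, yBar, sinK, cosK, hk, hk.ne', if_true, if_false, h2, h3]
  simp

lemma surjOn_areaFun (k : ℝ) : SurjOn (areaFun k) (areaFunDomain k) (areaFunRange k) := by
  intro y hy
  by_cases hk : k ≤ 0
  · simp only [areaFunRange, areaFunDomain, hk, if_true, mem_Ici] at hy ⊢
    -- For `k ≤ 0`, `H_k(s) ≥ s³ / 2`; at `s = 2y + 1` this exceeds `y`, which gives an upper end
    -- for the intermediate value theorem.
    have h1 : y ≤ areaFun k (2 * y + 1) := by
      have ha := le_sinK_of_nonpos hk (s := 2 * y + 1) (by linarith)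
      have hb := sq_div_two_le_yBar_of_nonpos hk (s := 2 * y + 1) (by linarith)
      have : (2 * y + 1) * ((2 * y + 1) ^ 2 / 2) ≤ areaFun k (2 * y + 1) :=
        mul_le_mul ha hb (by positivity) (by unfold xBar; linarith)
      nlinarith [mul_nonneg hy hy, mul_nonneg hy (mul_nonneg hy hy)]
    obtain ⟨x, hx, rfl⟩ := intermediate_value_Icc (a := 0) (b := 2 * y + 1) (by linarith)
      (continuous_areaFun k).continuousOn ⟨by simpa using hy, h1⟩
    exact ⟨x, hx.1, rfl⟩
  · simp only [areaFunRange, areaFunDomain, hk, if_false] at hy ⊢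
    have := Real.sqrt_pos.2 (not_le.1 hk)
    have hpi := Real.pi_pos
    refine intermediate_value_Icc (by positivity) (continuous_areaFun k).continuousOn ?_
    rwa [areaFun_zero, areaFun_pi_div (not_le.1 hk)]

lemma areaFunInv_mem {k y : ℝ} (hy : y ∈ areaFunRange k) : areaFunInv k y ∈ areaFunDomain k :=
  Function.invFunOn_mem (surjOn_areaFun k hy)

lemma areaFun_areaFunInv {k y : ℝ} (hy : y ∈ areaFunRange k) : areaFun k (areaFunInv k y) = y :=
  Function.invFunOn_eq (surjOn_areaFun k hy)

/-! ### Sturm comparison -/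

/-- Sturm comparison from below: a solution of `S'' = -κ S` with `S a = 0`, `S' a = 1` and
`κ ≤ ω ^ 2` does not change its sign on an interval shorter than `π / ω`. -/
lemma nonneg_of_hasDerivWithinAt_of_curvature_le {S S' κ : ℝ → ℝ} {a b ω : ℝ}
    (hω : 0 < ω) (hab : ω * (b - a) < Real.pi)
    (hS : ∀ t ∈ Icc a b, HasDerivWithinAt S (S' t) (Icc a b) t)
    (hS' : ∀ t ∈ Icc a b, HasDerivWithinAt S' (-(κ t * S t)) (Icc a b) t)
    (hκ : ∀ t ∈ Icc a b, κ t ≤ ω ^ 2) (h0 : S a = 0) (h1 : S' a = 1) :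
    ∀ t ∈ Icc a b, 0 ≤ S t := by
  intro t ht
  by_contra! hneg
  have hat : a < t := lt_of_le_of_ne ht.1 (by rintro rfl; exact absurd h0 hneg.ne)
  have hlt : a < b := hat.trans_le ht.2
  -- Centred at the midpoint, this solution of `φ'' = -ω² φ` is positive on all of `[a, b]`, because
  -- `ω (b - a) < π`.
  set φ : ℝ → ℝ := fun x => Real.cos (ω * (x - (a + b) / 2)) with hφ
  set φ' : ℝ → ℝ := fun x => -(ω * Real.sin (ω * (x - (a + b) / 2))) with hφ'
  have hlin (x : ℝ) : HasDerivAt (fun x : ℝ => ω * (x - (a + b) / 2)) ω x := by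
    simpa using ((hasDerivAt_id x).sub_const ((a + b) / 2)).const_mul ω
  have dφ (x : ℝ) : HasDerivAt φ (φ' x) x := by
    exact (hlin x).cos.congr_deriv (by simp only [hφ']; ring)
  have dφ' (x : ℝ) : HasDerivAt φ' (-(ω ^ 2 * φ x)) x := by
    exact ((hlin x).sin.const_mul ω).neg.congr_deriv (by simp only [hφ]; ring)
  have hpos : ∀ x ∈ Icc a b, 0 < φ x := fun x hx => by
    have e1 : ω * a ≤ ω * x := by gcongr; exact hx.1
    have e2 : ω * x ≤ ω * b := by gcongr; exact hx.2
    exact Real.cos_pos_of_mem_Ioo ⟨by nlinarith, by nlinarith⟩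
  have dg : ∀ x ∈ Icc a b, HasDerivWithinAt (fun x => S x / φ x)
      ((S' x * φ x - S x * φ' x) / φ x ^ 2) (Icc a b) x := fun x hx =>
    (hS x hx).div (dφ x).hasDerivWithinAt (hpos x hx).ne'
  have dW : ∀ x ∈ Icc a b, HasDerivWithinAt (fun x => S' x * φ x - S x * φ' x)
      ((ω ^ 2 - κ x) * S x * φ x) (Icc a b) x := fun x hx => by
    exact (((hS' x hx).mul (dφ x).hasDerivWithinAt).sub
      ((hS x hx).mul (dφ' x).hasDerivWithinAt)).congr_deriv (by ring)
  -- With `g = S / φ` and the Wronskian `W = φ² g'`, the derivative of `g W` is `W² / φ² + (ω² - κ)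
  -- S² ≥ 0`. As `g W` vanishes at `a`, it follows that `g g' ≥ 0` and `g²` increases. No sign of
  -- `S` is needed.
  have mN := monotoneOn_Icc_of_hasDerivWithinAt (a := a) (b := b)
    (fun x hx => (dg x hx).mul (dW x hx)) fun x hx => by
      have := hpos x hx
      have e : S x / φ x * ((ω ^ 2 - κ x) * S x * φ x) = (ω ^ 2 - κ x) * S x ^ 2 := by field_simp
      have e2 : 0 ≤ ω ^ 2 - κ x := sub_nonneg.2 (hκ x hx)
      rw [e, div_mul_eq_mul_div, ← sq]
      positivity
  have mg := monotoneOn_Icc_of_hasDerivWithinAt (a := a) (b := b)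
    (fun x hx => (dg x hx).mul (dg x hx)) fun x hx => by
      have h := mN (left_mem_Icc.2 hlt.le) hx hx.1
      simp only [Pi.mul_apply, h0, zero_div, zero_mul] at h
      have e : (S' x * φ x - S x * φ' x) / φ x ^ 2 * (S x / φ x) +
          S x / φ x * ((S' x * φ x - S x * φ' x) / φ x ^ 2) =
          2 * (S x / φ x * (S' x * φ x - S x * φ' x)) / φ x ^ 2 := by ring
      rw [e]
      positivity
  -- Since `S' a = 1`, `S` is positive just after `a`. A later negative value forces a zero in
  -- between, where `g²` would have dropped to `0`.
  obtain ⟨x, hx, hSx⟩ : ∃ x ∈ Ioo a t, 0 < S x := by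
    have hd := hS a (left_mem_Icc.2 hlt.le)
    rw [h1, hasDerivWithinAt_iff_tendsto_slope] at hd
    have hev := (hd.eventually (lt_mem_nhds one_pos)).filter_mono
      (nhdsWithin_mono a (show Ioo a t ⊆ Icc a b \ {a} from fun x hx =>
        ⟨⟨hx.1.le, hx.2.le.trans ht.2⟩, hx.1.ne'⟩))
    have : (nhdsWithin a (Ioo a t)).NeBot := left_nhdsWithin_Ioo_neBot hat
    obtain ⟨x, hx, hxa⟩ := (hev.and self_mem_nhdsWithin).exists
    refine ⟨x, hxa, ?_⟩
    rw [slope_def_field, h0, sub_zero] at hx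
    exact (div_pos_iff_of_pos_right (sub_pos.2 hxa.1)).1 hx
  obtain ⟨z, hz, hSz⟩ := intermediate_value_Icc' hx.2.le
    (fun y hy => ((hS y ⟨hx.1.le.trans hy.1, hy.2.trans ht.2⟩).continuousWithinAt.mono
      (Icc_subset_Icc hx.1.le ht.2))) ⟨hneg.le, hSx.le⟩
  have hxI : x ∈ Icc a b := ⟨hx.1.le, hx.2.le.trans ht.2⟩
  have := mg hxI ⟨hx.1.le.trans hz.1, hz.2.trans ht.2⟩ hz.1
  simp only [Pi.mul_apply, hSz, zero_div, zero_mul] at this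
  have := mul_pos (div_pos hSx (hpos x hxI)) (div_pos hSx (hpos x hxI))
  linarith

/-- Sturm comparison from above. -/
lemma le_sinK_of_le_curvature {S S' κ : ℝ → ℝ} {a b k : ℝ} (hab : a ≤ b)
    (hk : 0 < k → √k * (b - a) < Real.pi)
    (hS : ∀ t ∈ Icc a b, HasDerivWithinAt S (S' t) (Icc a b) t)
    (hS' : ∀ t ∈ Icc a b, HasDerivWithinAt S' (-(κ t * S t)) (Icc a b) t)
    (hκ : ∀ t ∈ Icc a b, k ≤ κ t) (h0 : S a = 0) (h1 : S' a = 1)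
    (hnonneg : ∀ t ∈ Icc a b, 0 ≤ S t) : S b ≤ sinK k (b - a) := by
  -- This Wronskian of `S` with the reflected model solution equals `sinK k (b - a)` at `a` and `S
  -- b` at `b`.
  have m := antitoneOn_Icc_of_hasDerivWithinAt (a := a) (b := b)
    (f := fun t => S' t * sinK k (b - t) + S t * cosK k (b - t))
    (f' := fun t => (k - κ t) * S t * sinK k (b - t))
    (fun t ht => by
      have e1 := ((hasDerivAt_sinK k (b - t)).comp_const_sub b t).hasDerivWithinAt (s := Icc a b)
      have e2 := ((hasDerivAt_cosK k (b - t)).comp_const_sub b t).hasDerivWithinAt (s := Icc a b)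
      exact (((hS' t ht).mul e1).add ((hS t ht).mul e2)).congr_deriv (by ring))
    (fun t ht => by
      have e1 : 0 ≤ sinK k (b - t) := sinK_nonneg (by linarith [ht.2]) fun h =>
        (mul_le_mul_of_nonneg_left (by linarith [ht.1]) (Real.sqrt_nonneg k)).trans_lt (hk h)
      exact mul_nonpos_of_nonpos_of_nonneg
        (mul_nonpos_of_nonpos_of_nonneg (sub_nonpos.2 (hκ t ht)) (hnonneg t ht)) e1)
  have := m (left_mem_Icc.2 hab) (right_mem_Icc.2 hab) hab
  simpa [h0, h1] using this

/-! ### Areas of triangles inscribed in a short arc -/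

lemma HasDerivWithinAt.wedge {f g : ℝ → Plane} {f' g' : Plane} {s : Set ℝ} {t : ℝ}
    (hf : HasDerivWithinAt f f' s t) (hg : HasDerivWithinAt g g' s t) :
    HasDerivWithinAt (fun x => wedge (f x) (g x)) (wedge f' (g t) + wedge (f t) g') s t := by
  have hp {f : ℝ → Plane} {f' : Plane} (hf : HasDerivWithinAt f f' s t) (i : Fin 2) :
      HasDerivWithinAt (fun x => f x i) (f' i) s t :=
    (EuclideanSpace.proj (𝕜 := ℝ) (ι := Fin 2) i).hasFDerivAt.comp_hasDerivWithinAt t hf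
  exact (((hp hf 0).mul (hp hg 1)).sub ((hp hf 1).mul (hp hg 0))).congr_deriv
    (by simp only [_root_.wedge]; ring)

lemma wedge_zero_left (v : Plane) : wedge 0 v = 0 := by simp [wedge]

lemma wedge_self (v : Plane) : wedge v v = 0 := by simp [wedge]; ring

lemma wedge_smul_right (k : ℝ) (v w : Plane) : wedge v (k • w) = k * wedge v w := by
  simp [wedge]; ring

lemma wedge_neg_right (v w : Plane) : wedge v (-w) = -wedge v w := by
  simp [wedge]; ring

lemma wedge_sub_right (v w x : Plane) : wedge v (w - x) = wedge v w - wedge v x := by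
  simp [wedge]; ring

lemma wedge_swap (v w : Plane) : wedge v w = -wedge w v := by
  simp [wedge]; ring

namespace IsAffineParametrization

variable {c : ℝ → Plane} {I : Set ℝ} {C : Set Plane}

lemma hasDerivWithinAt_iteratedDerivWithin (hc : IsAffineParametrization c I C) {n m : ℕ}
    (hn : n < 3) (hm : m = n + 1) {s : ℝ} (hs : s ∈ I) :
    HasDerivWithinAt (iteratedDerivWithin n c I) (iteratedDerivWithin m c I s) I s := by
  subst hm
  have hu : UniqueDiffOn ℝ I := uniqueDiffOn_convex hc.ordConnected.convex hc.interior_nonempty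
  rw [iteratedDerivWithin_succ]
  exact (hc.contDiffOn.differentiableOn_iteratedDerivWithin
    (by exact_mod_cast hn) hu s hs).hasDerivWithinAt

lemma hasDerivWithinAt (hc : IsAffineParametrization c I C) {s : ℝ} (hs : s ∈ I) :
    HasDerivWithinAt c (iteratedDerivWithin 1 c I s) I s := by
  simpa [iteratedDerivWithin_zero] using
    hc.hasDerivWithinAt_iteratedDerivWithin (n := 0) (m := 1) (by norm_num) rfl hs

/-- By `c''' = -κ c'`, the function `t ↦ c'(a) ∧ c'(t)` solves `S'' = -κ S`, and unit speed gives
`S'(a) = 1`. Both Sturm comparisons apply. -/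
lemma wedge_deriv_mem_Icc (hc : IsAffineParametrization c I C) {a b k ω : ℝ} (ha : a ∈ I)
    (hb : b ∈ I) (hab : a ≤ b) (hω : 0 < ω) (hωab : ω * (b - a) < Real.pi)
    (hk : 0 < k → √k * (b - a) < Real.pi)
    (hκ : ∀ s ∈ I, k ≤ affineCurvature c I s ∧ affineCurvature c I s ≤ ω ^ 2) :
    wedge (iteratedDerivWithin 1 c I a) (iteratedDerivWithin 1 c I b) ∈
      Icc 0 (sinK k (b - a)) := by
  have hI : Icc a b ⊆ I := hc.ordConnected.out ha hb
  obtain ⟨u, hu⟩ : ∃ u, u = iteratedDerivWithin 1 c I a := ⟨_, rfl⟩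
  rw [← hu]
  have hS : ∀ t ∈ Icc a b, HasDerivWithinAt (fun t => wedge u (iteratedDerivWithin 1 c I t))
      (wedge u (iteratedDerivWithin 2 c I t)) (Icc a b) t := fun t ht => by
    have := (hasDerivWithinAt_const t (Icc a b) u).wedge
      ((hc.hasDerivWithinAt_iteratedDerivWithin (n := 1) (m := 2) (by norm_num) rfl (hI ht)).mono hI)
    simpa [wedge_zero_left] using this
  have hS' : ∀ t ∈ Icc a b, HasDerivWithinAt (fun t => wedge u (iteratedDerivWithin 2 c I t))
      (-(affineCurvature c I t * wedge u (iteratedDerivWithin 1 c I t))) (Icc a b) t :=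
    fun t ht => by
      have := (hasDerivWithinAt_const t (Icc a b) u).wedge
        ((hc.hasDerivWithinAt_iteratedDerivWithin (n := 2) (m := 3) (by norm_num) rfl (hI ht)).mono hI)
      rw [affineCurvature_spec hc (hI ht), wedge_neg_right, wedge_smul_right] at this
      simpa [wedge_zero_left] using this
  have hone : wedge u (iteratedDerivWithin 2 c I a) = 1 := hu ▸ hc.unit_speed a ha
  have hnn := nonneg_of_hasDerivWithinAt_of_curvature_le (κ := affineCurvature c I)
    (S := fun t => wedge u (iteratedDerivWithin 1 c I t))
    (S' := fun t => wedge u (iteratedDerivWithin 2 c I t)) hω hωab hS hS'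
    (fun t ht => (hκ t (hI ht)).2) (hu ▸ wedge_self u) hone
  exact ⟨hnn b (right_mem_Icc.2 hab), le_sinK_of_le_curvature (κ := affineCurvature c I)
    (S := fun t => wedge u (iteratedDerivWithin 1 c I t))
    (S' := fun t => wedge u (iteratedDerivWithin 2 c I t)) hab hk hS hS'
    (fun t ht => (hκ t (hI ht)).1) (hu ▸ wedge_self u) hone hnn⟩

/-- First integration of `wedge_deriv_mem_Icc`, over the second argument from `b` to `d`, carried
out as monotonicity instead of with integrals. -/
lemma wedge_deriv_chord_mem_Icc (hc : IsAffineParametrization c I C) {a b d k ω : ℝ} (ha : a ∈ I)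
    (hd : d ∈ I) (hab : a ≤ b) (hbd : b ≤ d) (hω : 0 < ω) (hωad : ω * (d - a) < Real.pi)
    (hk : 0 < k → √k * (d - a) < Real.pi)
    (hκ : ∀ s ∈ I, k ≤ affineCurvature c I s ∧ affineCurvature c I s ≤ ω ^ 2) :
    wedge (iteratedDerivWithin 1 c I a) (c d - c b) ∈
      Icc 0 (yBar k (d - a) - yBar k (b - a)) := by
  have hI : Icc a d ⊆ I := hc.ordConnected.out ha hd
  have hJ : Icc b d ⊆ I := (Icc_subset_Icc_left hab).trans hI
  obtain ⟨u, hu⟩ : ∃ u, u = iteratedDerivWithin 1 c I a := ⟨_, rfl⟩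
  rw [← hu]
  have hS : ∀ t ∈ Icc b d, HasDerivWithinAt (fun t => wedge u (c t))
      (wedge u (iteratedDerivWithin 1 c I t)) (Icc b d) t := fun t ht => by
    have := (hasDerivWithinAt_const t (Icc b d) u).wedge ((hc.hasDerivWithinAt (hJ ht)).mono hJ)
    simpa [wedge_zero_left] using this
  have hb (t) (ht : t ∈ Icc b d) := hu ▸ hc.wedge_deriv_mem_Icc (k := k) ha (hJ ht) (hab.trans ht.1) hω
    ((mul_le_mul_of_nonneg_left (by linarith [ht.2]) hω.le).trans_lt hωad)
    (fun h => (mul_le_mul_of_nonneg_left (by linarith [ht.2]) (Real.sqrt_nonneg k)).trans_lt (hk h))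
    hκ
  have m1 := monotoneOn_Icc_of_hasDerivWithinAt hS fun t ht => (hb t ht).1
  have m2 := antitoneOn_Icc_of_hasDerivWithinAt (fun t ht => (hS t ht).sub
      ((hasDerivAt_yBar k (t - a)).comp_sub_const t a).hasDerivWithinAt)
    fun t ht => sub_nonpos.2 (hb t ht).2
  have r1 := m1 (left_mem_Icc.2 hbd) (right_mem_Icc.2 hbd) hbd
  have r2 := m2 (left_mem_Icc.2 hbd) (right_mem_Icc.2 hbd) hbd
  simp only [Pi.sub_apply] at r1 r2
  rw [wedge_sub_right]
  constructor <;> linarith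

/-- The area of a triangle inscribed in a short arc is at most the area of the largest triangle
inscribed in an arc of the same length and of constant affine curvature `k`. -/
lemma wedge_chords_mem_Icc (hc : IsAffineParametrization c I C) {a b d k ω : ℝ} (ha : a ∈ I)
    (hd : d ∈ I) (hab : a ≤ b) (hbd : b ≤ d) (hω : 0 < ω) (hωad : ω * (d - a) < Real.pi)
    (hk : 0 < k → √k * (d - a) < Real.pi)
    (hκ : ∀ s ∈ I, k ≤ affineCurvature c I s ∧ affineCurvature c I s ≤ ω ^ 2) :
    wedge (c b - c a) (c d - c b) ∈ Icc 0 (2 * areaFun k ((d - a) / 2)) := by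
  have hI : Icc a d ⊆ I := hc.ordConnected.out ha hd
  have hJ : Icc a b ⊆ I := (Icc_subset_Icc_right hbd).trans hI
  set v := c d - c b with hv
  have hS : ∀ t ∈ Icc a b, HasDerivWithinAt (fun t => wedge (c t) v)
      (wedge (iteratedDerivWithin 1 c I t) v) (Icc a b) t := fun t ht => by
    have := ((hc.hasDerivWithinAt (hJ ht)).mono hJ).wedge (hasDerivWithinAt_const t (Icc a b) v)
    simpa [_root_.wedge] using this
  have hb (t) (ht : t ∈ Icc a b) := hc.wedge_deriv_chord_mem_Icc (k := k) (hJ ht) hd ht.2 hbd hω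
    ((mul_le_mul_of_nonneg_left (by linarith [ht.1]) hω.le).trans_lt hωad)
    (fun h => (mul_le_mul_of_nonneg_left (by linarith [ht.1]) (Real.sqrt_nonneg k)).trans_lt (hk h))
    hκ
  have m1 := monotoneOn_Icc_of_hasDerivWithinAt hS fun t ht => (hb t ht).1
  -- Second integration, over the starting point `t` from `a` to `b`: the added primitives have
  -- derivative `yBar k (b - t) - yBar k (d - t)`, which cancels the upper bound for the chord.
  have m2 := antitoneOn_Icc_of_hasDerivWithinAt (fun t ht => (hS t ht).add
      (((hasDerivAt_yBarPrimitive k (d - t)).comp_const_sub d t).sub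
      ((hasDerivAt_yBarPrimitive k (b - t)).comp_const_sub b t)).hasDerivWithinAt)
    fun t ht => by linarith [(hb t ht).2]
  have r1 := m1 (left_mem_Icc.2 hab) (right_mem_Icc.2 hab) hab
  have r2 := m2 (left_mem_Icc.2 hab) (right_mem_Icc.2 hab) hab
  simp only [Pi.sub_apply, Pi.add_apply, sub_self, yBarPrimitive_zero] at r1 r2
  have r3 := yBarPrimitive_sub_le (k := k) (p := b - a) (q := d - b) (by linarith) (by linarith)
    (by rwa [show b - a + (d - b) = d - a by ring])
  rw [show b - a + (d - b) = d - a by ring] at r3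
  have e : wedge (c b - c a) v = wedge (c b) v - wedge (c a) v := by
    simp [_root_.wedge]; ring
  rw [e]
  constructor <;> linarith

end IsAffineParametrization

/-! ### No three collinear points on a convex curve -/

open scoped Topology

lemma continuous_wedge_sub (v p : Plane) : Continuous fun x => wedge v (x - p) := by
  unfold wedge
  fun_prop

/-- A point with positive barycentric coordinates with respect to a triangle is an interior point
of every convex set that contains the vertices. -/
lemma mem_interior_of_wedge_pos {K : Set Plane} (hK : Convex ℝ K) {p q r x : Plane} (hp : p ∈ K)
    (hq : q ∈ K) (hr : r ∈ K) (h1 : 0 < wedge (q - p) (x - p)) (h2 : 0 < wedge (r - q) (x - q))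
    (h3 : 0 < wedge (p - r) (x - r)) : x ∈ interior K := by
  refine mem_interior.2 ⟨{x | 0 < wedge (q - p) (x - p)} ∩ {x | 0 < wedge (r - q) (x - q)} ∩
    {x | 0 < wedge (p - r) (x - r)}, ?_, ?_, ⟨⟨h1, h2⟩, h3⟩⟩
  · rintro y ⟨⟨h1, h2⟩, h3⟩
    simp only [mem_ofPred_eq] at h1 h2 h3
    have hD : wedge (q - p) (y - p) + wedge (r - q) (y - q) + wedge (p - r) (y - r) =
        wedge (q - p) (r - p) := by simp [wedge]; ring
    set a := wedge (q - p) (y - p) with ha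
    set b := wedge (r - q) (y - q) with hb
    set d := wedge (p - r) (y - r) with hd
    have hpos : 0 < a + b + d := by positivity
    -- Each vertex is weighted by the signed area over the opposite side, so `a`, which belongs to
    -- the side `p q`, goes with `r`.
    have e : (b / (a + b + d)) • p + (d / (a + b + d)) • q + (a / (a + b + d)) • r = y := by
      have : (b • p + d • q + a • r) = (a + b + d) • y := by
        rw [ha, hb, hd]
        ext i
        fin_cases i <;> simp [wedge] <;> ring
      rw [← inv_smul_smul₀ hpos.ne' y, ← this]
      simp only [smul_add, smul_smul]
      congr 1; congr 1
      all_goals congr 1; ring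
    rw [← e]
    have := hK.sum_mem (t := Finset.univ) (z := ![p, q, r])
      (w := ![b / (a + b + d), d / (a + b + d), a / (a + b + d)])
      (fun i _ => by fin_cases i <;> simp <;> positivity)
      (by simp [Fin.sum_univ_three]; field_simp; ring)
      (fun i _ => by fin_cases i <;> simpa)
    simpa [Fin.sum_univ_three] using this
  · exact ((isOpen_lt continuous_const (continuous_wedge_sub _ _)).inter
      (isOpen_lt continuous_const (continuous_wedge_sub _ _))).inter
      (isOpen_lt continuous_const (continuous_wedge_sub _ _))

/-- A convex set that contains `p`, `r` and a point `q` to the left of the line from `p` to `r`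
contains a half disc on that side around every point of the open segment. -/
lemma eventually_mem_interior {K : Set Plane} (hK : Convex ℝ K) {p q r x : Plane} (hp : p ∈ K)
    (hr : r ∈ K) (hq : q ∈ K) (hpos : 0 < wedge (r - p) (q - p)) (hx : x ∈ openSegment ℝ p r) :
    ∀ᶠ y in 𝓝 x, 0 < wedge (r - p) (y - p) → y ∈ interior K := by
  obtain ⟨a, b, ha, hb, hab, rfl⟩ := hx
  have e2 : 0 < wedge (q - r) (a • p + b • r - r) := by
    have : wedge (q - r) (a • p + b • r - r) = a * wedge (r - p) (q - p) := by
      obtain rfl : b = 1 - a := by linarith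
      simp [wedge]; ring
    rw [this]; positivity
  have e3 : 0 < wedge (p - q) (a • p + b • r - q) := by
    have : wedge (p - q) (a • p + b • r - q) = b * wedge (r - p) (q - p) := by
      obtain rfl : b = 1 - a := by linarith
      simp [wedge]; ring
    rw [this]; positivity
  filter_upwards [(continuous_wedge_sub (q - r) r).continuousAt.eventually (lt_mem_nhds e2),
    (continuous_wedge_sub (p - q) q).continuousAt.eventually (lt_mem_nhds e3)] with y h2 h3 h1
  exact mem_interior_of_wedge_pos hK hp hr hq h1 h2 h3

namespace IsAffineParametrization

variable {c : ℝ → Plane} {I : Set ℝ} {C : Set Plane}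

/-- If the curve stayed on a line near `s`, two differentiations would make `c'` and `c''` both
parallel to `v`, against `c' ∧ c'' = 1`. -/
lemma not_eventually_wedge_eq_zero (hc : IsAffineParametrization c I C) {v p : Plane} (hv : v ≠ 0)
    {s : ℝ} (hs : s ∈ I) : ¬ ∀ᶠ t in 𝓝[I] s, wedge v (c t - p) = 0 := by
  intro h
  have hu : UniqueDiffOn ℝ I := uniqueDiffOn_convex hc.ordConnected.convex hc.interior_nonempty
  have step {f : ℝ → Plane} {f' : ℝ → Plane} (hf : ∀ t ∈ I, HasDerivWithinAt f (f' t) I t)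
      (h : ∀ᶠ t in 𝓝[I] s, wedge v (f t) = 0) : ∀ᶠ t in 𝓝[I] s, wedge v (f' t) = 0 := by
    filter_upwards [eventually_eventually_nhdsWithin.2 h, self_mem_nhdsWithin] with t ht htI
    have h1 := (hasDerivWithinAt_const t I v).wedge (hf t htI)
    have h2 : HasDerivWithinAt (fun t => wedge v (f t)) 0 I t :=
      (hasDerivWithinAt_const t I (0 : ℝ)).congr_of_eventuallyEq ht (ht.self_of_nhdsWithin htI)
    simpa [wedge_zero_left] using (hu t htI).eq_deriv I h1 h2
  have h1 := step (fun t ht => (hc.hasDerivWithinAt ht).sub_const p) h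
  have h2 := step (fun t ht =>
    hc.hasDerivWithinAt_iteratedDerivWithin (n := 1) (m := 2) (by norm_num) rfl ht) h1
  have e1 := h1.self_of_nhdsWithin hs
  have e2 := h2.self_of_nhdsWithin hs
  have e3 := hc.unit_speed s hs
  simp only [_root_.wedge] at e1 e2 e3
  apply hv
  ext i
  fin_cases i
  · simp only [Fin.zero_eta, PiLp.zero_apply]
    linear_combination (-v 0) * e3 - iteratedDerivWithin 2 c I s 0 * e1 +
      iteratedDerivWithin 1 c I s 0 * e2
  · simp only [Fin.mk_one, PiLp.zero_apply]
    linear_combination (-v 1) * e3 - iteratedDerivWithin 2 c I s 1 * e1 +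
      iteratedDerivWithin 1 c I s 1 * e2

/-- A curve point strictly on one side of the line `p r` puts a half disc around `q` on that side
into the interior of the hull, so near `q` the curve must avoid that side. As it cannot stay on the
line, it has points on both sides; then both sides are forbidden near `q`, a contradiction. -/
lemma notMem_openSegment (hc : IsAffineParametrization c I C) (hconv : IsConvexCurve C)
    {p q r : Plane} (hp : p ∈ C) (hq : q ∈ C) (hr : r ∈ C) (hpr : p ≠ r) :
    q ∉ openSegment ℝ p r := by
  intro hqm
  obtain ⟨s, hs, rfl⟩ : q ∈ c '' I := by rwa [hc.image_eq]
  have hK := convex_convexHull ℝ C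
  have hsub := subset_convexHull ℝ C
  have hmem : ∀ t ∈ I, c t ∈ C := fun t ht => hc.image_eq ▸ mem_image_of_mem c ht
  have hcont : Filter.Tendsto c (𝓝[I] s) (𝓝 (c s)) := hc.contDiffOn.continuousOn s hs
  have key {p r : Plane} (hp : p ∈ C) (hr : r ∈ C) (hq : c s ∈ openSegment ℝ p r) {t₀ : ℝ}
      (ht₀ : t₀ ∈ I) (hpos : 0 < wedge (r - p) (c t₀ - p)) :
      ∀ᶠ t in 𝓝[I] s, wedge (r - p) (c t - p) ≤ 0 := by
    filter_upwards [hcont.eventually (eventually_mem_interior hK (hsub hp) (hsub hr)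
      (hsub (hmem t₀ ht₀)) hpos hq), self_mem_nhdsWithin] with t ht htI
    by_contra! h
    exact (hconv (hmem t htI)).2 (ht h)
  have hne := hc.not_eventually_wedge_eq_zero (p := p) (sub_ne_zero.2 hpr.symm) hs
  have hflip (t : ℝ) : wedge (p - r) (c t - r) = -wedge (r - p) (c t - p) := by
    simp [_root_.wedge]; ring
  have hneg {t₀ : ℝ} (ht₀ : t₀ ∈ I) (h : wedge (r - p) (c t₀ - p) < 0) :
      ∀ᶠ t in 𝓝[I] s, 0 ≤ wedge (r - p) (c t - p) := by
    filter_upwards [key hr hp (openSegment_symm ℝ p r ▸ hqm) ht₀ (by rw [hflip]; linarith)] with t ht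
    rw [hflip] at ht
    linarith
  have hex : ∀ {P : ℝ → Prop}, (∀ᶠ t in 𝓝[I] s, P t) →
      ∃ t ∈ I, P t ∧ wedge (r - p) (c t - p) ≠ 0 := fun {P} hP => by
    obtain ⟨t, ht, h1, h2⟩ :=
      ((Filter.not_eventually.1 hne).and_eventually (hP.and self_mem_nhdsWithin)).exists
    exact ⟨t, h2, h1, ht⟩
  have both {t₁ t₂ : ℝ} (h₁ : t₁ ∈ I) (h₂ : t₂ ∈ I) (hp₁ : 0 < wedge (r - p) (c t₁ - p))
      (hp₂ : wedge (r - p) (c t₂ - p) < 0) : False :=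
    hne (((key hp hr hqm h₁ hp₁).and (hneg h₂ hp₂)).mono fun t ht => le_antisymm ht.1 ht.2)
  obtain ⟨t₁, h₁, -, hn₁⟩ := hex (Filter.eventually_true _)
  rcases hn₁.lt_or_gt with h | h
  · obtain ⟨t₂, h₂, hs₂, hn₂⟩ := hex (hneg h₁ h)
    exact both h₂ h₁ (hs₂.lt_of_ne' hn₂) h
  · obtain ⟨t₂, h₂, hs₂, hn₂⟩ := hex (key hp hr hqm h₁ h)
    exact both h₁ h₂ h (hs₂.lt_of_ne hn₂)

/-- No three distinct points of a convex curve with a parametrization by affine arc length are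
collinear. -/
lemma wedge_sub_ne_zero (hc : IsAffineParametrization c I C) (hconv : IsConvexCurve C)
    {p q r : Plane} (hp : p ∈ C) (hq : q ∈ C) (hr : r ∈ C) (hpq : p ≠ q) (hpr : p ≠ r)
    (hqr : q ≠ r) : wedge (q - p) (r - p) ≠ 0 := by
  intro h
  obtain ⟨k, hk⟩ : ∃ k : ℝ, r = AffineMap.lineMap p q k := by
    have hv := sub_ne_zero.2 hpq.symm
    have hn : (q - p) 0 ≠ 0 ∨ (q - p) 1 ≠ 0 := by
      by_contra! h0
      exact hv (by ext i; fin_cases i <;> [exact h0.1; exact h0.2])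
    simp only [_root_.wedge] at h
    rcases hn with h0 | h0
    · refine ⟨(r - p) 0 / (q - p) 0, ?_⟩
      rw [AffineMap.lineMap_apply_module', eq_comm, ← eq_sub_iff_add_eq]
      ext i
      fin_cases i <;> simp only [Fin.zero_eta, Fin.mk_one, PiLp.smul_apply, smul_eq_mul]
      · field_simp
      · field_simp; linarith
    · refine ⟨(r - p) 1 / (q - p) 1, ?_⟩
      rw [AffineMap.lineMap_apply_module', eq_comm, ← eq_sub_iff_add_eq]
      ext i
      fin_cases i <;> simp only [Fin.zero_eta, Fin.mk_one, PiLp.smul_apply, smul_eq_mul]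
      · field_simp; linarith
      · field_simp
  have hcol : Collinear ℝ {p, q, r} := by
    rw [show ({p, q, r} : Set Plane) = {r, p, q} by ext; simp; tauto]
    exact (collinear_insert_iff_of_mem_affineSpan
      (hk ▸ AffineMap.lineMap_mem_affineSpan_pair k p q)).2 (collinear_pair ℝ p q)
  rcases hcol.wbtw_or_wbtw_or_wbtw with hb | hb | hb
  · exact hc.notMem_openSegment hconv hp hq hr hpr
      (mem_openSegment_of_ne_left_right hpq hqr.symm hb.mem_segment)
  · exact hc.notMem_openSegment hconv hq hr hp hpq.symm
      (mem_openSegment_of_ne_left_right hqr hpr hb.mem_segment)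
  · exact hc.notMem_openSegment hconv hr hp hq hqr.symm
      (mem_openSegment_of_ne_left_right hpr.symm hpq.symm hb.mem_segment)

end IsAffineParametrization

/-! ### Lattice triangles and the multiplicity `𝔪` -/

lemma wedge_ne_zero_of_linearIndependent {v w : Plane} (h : LinearIndependent ℝ ![v, w]) :
    wedge v w ≠ 0 := by
  intro h0
  rw [LinearIndependent.pair_iff] at h
  have hz {a b : ℝ} (h1 : a * v 0 + b * w 0 = 0) (h2 : a * v 1 + b * w 1 = 0) :
      a = 0 ∧ b = 0 :=
    h a b (by ext i; fin_cases i <;> [simpa using h1; simpa using h2])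
  simp only [wedge] at h0
  have h1 := hz (a := w 1) (b := -v 1) (by linarith) (by ring)
  have h2 := hz (a := w 0) (b := -v 0) (by ring) (by linarith)
  have := hz (a := 1) (b := 0) (by simp; linarith [h2.2]) (by simp; linarith [h1.2])
  exact one_ne_zero this.1

/-- In lattice coordinates the wedge is an integer determinant times `v₁ ∧ v₂`, and a nonzero
integer has absolute value at least `1`. -/
lemma latticeArea_le_of_wedge_ne_zero {v₀ v₁ v₂ p q r : Plane} (hp : p ∈ planeLattice v₀ v₁ v₂)
    (hq : q ∈ planeLattice v₀ v₁ v₂) (hr : r ∈ planeLattice v₀ v₁ v₂)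
    (h : wedge (q - p) (r - p) ≠ 0) : latticeArea v₁ v₂ / 2 ≤ triangleArea p q r := by
  obtain ⟨m, n, rfl⟩ := hp
  obtain ⟨m', n', rfl⟩ := hq
  obtain ⟨m'', n'', rfl⟩ := hr
  have e : wedge (v₀ + (m' : ℝ) • v₁ + (n' : ℝ) • v₂ - (v₀ + (m : ℝ) • v₁ + (n : ℝ) • v₂))
      (v₀ + (m'' : ℝ) • v₁ + (n'' : ℝ) • v₂ - (v₀ + (m : ℝ) • v₁ + (n : ℝ) • v₂)) =
      (((m' - m) * (n'' - n) - (n' - n) * (m'' - m) : ℤ) : ℝ) * wedge v₁ v₂ := by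
    push_cast
    simp [wedge]
    ring
  rw [e] at h
  have h1 : (1 : ℝ) ≤ |(((m' - m) * (n'' - n) - (n' - n) * (m'' - m) : ℤ) : ℝ)| := by
    exact_mod_cast Int.one_le_abs (by exact_mod_cast left_ne_zero_of_mul h)
  rw [triangleArea, latticeArea, e, abs_mul]
  have := le_mul_of_one_le_left (abs_nonneg (wedge v₁ v₂)) h1
  linarith

/-- Three points make the `sSup` a true maximum: `1` is admissible because no triple is collinear,
and the area of the triangle `p q r` bounds every admissible integer. -/
lemma areaMultiplicity_spec {C : Set Plane} {c : ℝ → Plane} {I : Set ℝ} {v₀ v₁ v₂ : Plane}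
    (hc : IsAffineParametrization c I C) (hconv : IsConvexCurve C)
    (hv : LinearIndependent ℝ ![v₁, v₂]) {p q r : Plane} (hp : p ∈ planeLattice v₀ v₁ v₂ ∩ C)
    (hq : q ∈ planeLattice v₀ v₁ v₂ ∩ C) (hr : r ∈ planeLattice v₀ v₁ v₂ ∩ C) (hpq : p ≠ q)
    (hpr : p ≠ r) (hqr : q ≠ r) :
    0 < areaMultiplicity C v₀ v₁ v₂ ∧ ∀ p₁ ∈ planeLattice v₀ v₁ v₂ ∩ C,
      ∀ p₂ ∈ planeLattice v₀ v₁ v₂ ∩ C, ∀ p₃ ∈ planeLattice v₀ v₁ v₂ ∩ C, p₁ ≠ p₂ → p₁ ≠ p₃ →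
      p₂ ≠ p₃ → (areaMultiplicity C v₀ v₁ v₂ : ℝ) / 2 * latticeArea v₁ v₂ ≤
        triangleArea p₁ p₂ p₃ := by
  have hA : 0 < latticeArea v₁ v₂ := abs_pos.2 (wedge_ne_zero_of_linearIndependent hv)
  refine Nat.sSup_mem (s := {n : ℕ | 0 < n ∧ ∀ p₁ ∈ planeLattice v₀ v₁ v₂ ∩ C,
    ∀ p₂ ∈ planeLattice v₀ v₁ v₂ ∩ C, ∀ p₃ ∈ planeLattice v₀ v₁ v₂ ∩ C, p₁ ≠ p₂ → p₁ ≠ p₃ →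
      p₂ ≠ p₃ → (n : ℝ) / 2 * latticeArea v₁ v₂ ≤ triangleArea p₁ p₂ p₃}) ⟨1, one_pos, fun p₁ h₁ p₂ h₂ p₃ h₃ h₁₂ h₁₃ h₂₃ => ?_⟩
    ⟨⌈2 * triangleArea p q r / latticeArea v₁ v₂⌉₊, fun n hn => ?_⟩
  · have := latticeArea_le_of_wedge_ne_zero h₁.1 h₂.1 h₃.1
      (hc.wedge_sub_ne_zero hconv h₁.2 h₂.2 h₃.2 h₁₂ h₁₃ h₂₃)
    push_cast
    linarith
  · have h := hn.2 p hp q hq r hr hpq hpr hqr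
    have : (n : ℝ) ≤ 2 * triangleArea p q r / latticeArea v₁ v₂ := by
      rw [le_div_iff₀ hA]
      linarith
    exact_mod_cast this.trans (Nat.le_ceil _)

/-! ### Short arcs and the final count -/

lemma triangleArea_swap_left (p q r : Plane) : triangleArea p q r = triangleArea q p r := by
  unfold triangleArea
  rw [show wedge (q - p) (r - p) = -wedge (p - q) (r - q) by simp [wedge]; ring, abs_neg]

lemma triangleArea_swap_right (p q r : Plane) : triangleArea p q r = triangleArea p r q := by
  unfold triangleArea
  rw [wedge_swap, abs_neg]

namespace IsAffineParametrization

variable {c : ℝ → Plane} {I : Set ℝ} {C : Set Plane}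

/-- The choice `ω = π / (2L)` turns the Sturm condition `ω (d - a) < π` into `d - a < 2L`.
Strictness comes from the strict monotonicity of `H_k`. -/
lemma triangleArea_lt_areaFun (hc : IsAffineParametrization c I C) {k L : ℝ} (hL : 0 < L)
    (hLk : L ∈ areaFunDomain k)
    (hκ : ∀ s ∈ I, k ≤ affineCurvature c I s ∧
      affineCurvature c I s ≤ (Real.pi / (2 * L)) ^ 2) {a b d : ℝ} (ha : a ∈ I)
    (hd : d ∈ I) (hab : a ≤ b) (hbd : b ≤ d) (had : d - a < 2 * L) :
    triangleArea (c a) (c b) (c d) < areaFun k L := by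
  have hk := (mem_areaFunDomain.1 hLk).2
  have h := hc.wedge_chords_mem_Icc (k := k) (ω := Real.pi / (2 * L)) ha hd hab hbd
    (by have := Real.pi_pos; positivity)
    (by rw [div_mul_eq_mul_div, div_lt_iff₀ (by positivity)]
        exact mul_lt_mul_of_pos_left had Real.pi_pos)
    (fun h => by nlinarith [hk h, Real.sqrt_pos.2 h]) hκ
  have hmono : areaFun k ((d - a) / 2) < areaFun k L :=
    areaFun_strictMonoOn k (mem_areaFunDomain.2 ⟨by linarith, fun h =>
      (mul_le_mul_of_nonneg_left (by linarith) (Real.sqrt_nonneg k)).trans (hk h)⟩) hLk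
      (by linarith)
  have e : wedge (c b - c a) (c d - c a) = wedge (c b - c a) (c d - c b) := by
    simp [_root_.wedge]; ring
  rw [triangleArea, e, abs_of_nonneg h.1]
  linarith [h.2]

lemma triangleArea_lt_areaFun_of_abs_lt (hc : IsAffineParametrization c I C) {k L : ℝ}
    (hL : 0 < L) (hLk : L ∈ areaFunDomain k)
    (hκ : ∀ s ∈ I, k ≤ affineCurvature c I s ∧
      affineCurvature c I s ≤ (Real.pi / (2 * L)) ^ 2) {a b d : ℝ} (ha : a ∈ I) (hb : b ∈ I)
    (hd : d ∈ I) (hab : |a - b| < 2 * L) (had : |a - d| < 2 * L) (hbd : |b - d| < 2 * L) :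
    triangleArea (c a) (c b) (c d) < areaFun k L := by
  wlog h₁ : a ≤ b generalizing a b
  · rw [triangleArea_swap_left]
    exact this hb ha (by rwa [abs_sub_comm]) hbd had (le_of_not_ge h₁)
  wlog h₂ : b ≤ d generalizing b d
  · rw [triangleArea_swap_right]
    rcases le_total a d with h | h
    · exact this hb hd had hab (by rwa [abs_sub_comm]) h (le_of_not_ge h₂)
    · rw [triangleArea_swap_left]
      exact hc.triangleArea_lt_areaFun hL hLk hκ hd hb h h₁
        (by linarith [neg_lt_of_abs_lt hbd, lt_of_abs_lt hbd])
  exact hc.triangleArea_lt_areaFun hL hLk hκ ha hd h₁ h₂ (by linarith [neg_lt_of_abs_lt had])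

lemma affineLength_eq (hc : IsAffineParametrization c I C) :
    affineLength c I = volume.real I := by
  have hm : MeasurableSet I := hc.ordConnected.measurableSet
  rw [affineLength, setIntegral_congr_fun hm (g := fun _ => (1 : ℝ))
    fun t ht => by simp only [hc.unit_speed t ht, Real.one_rpow]]
  simp

lemma sub_le_affineLength (hc : IsAffineParametrization c I C) (hI : Bornology.IsBounded I)
    {s t : ℝ} (hs : s ∈ I) (ht : t ∈ I) : t - s ≤ affineLength c I := by
  rw [hc.affineLength_eq]
  rcases le_total s t with h | h
  · have := measureReal_mono (μ := volume) (hc.ordConnected.out hs ht) hI.measure_lt_top.ne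
    rwa [Real.volume_real_Icc_of_le h] at this
  · linarith [measureReal_nonneg (μ := volume) (s := I)]

end IsAffineParametrization

/-- A set of points on an arc of length less than `(m + 1) ℓ` has at most `2 (m + 1)` points
if no subarc of length less than `ℓ` contains three of them. -/
lemma encard_le_of_forall_not_three {α : Type*} {P : Set α} {θ : α → ℝ} {x ℓ : ℝ} {m : ℕ}
    (hℓ : 0 < ℓ) (hθ : ∀ p ∈ P, x ≤ θ p ∧ θ p - x < (m + 1) * ℓ)
    (h3 : ∀ p ∈ P, ∀ q ∈ P, ∀ r ∈ P, p ≠ q → p ≠ r → q ≠ r → |θ p - θ q| < ℓ →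
      |θ p - θ r| < ℓ → |θ q - θ r| < ℓ → False) :
    P.encard ≤ ((2 * m + 2 : ℕ) : ℕ∞) := by
  by_contra! hlt
  obtain ⟨Q, hQP, hQ⟩ := exists_subset_encard_eq (Order.add_one_le_of_lt hlt)
  have hfin : Q.Finite := finite_of_encard_eq_coe (k := 2 * m + 2 + 1) (by rw [hQ]; push_cast; rfl)
  lift Q to Finset α using hfin
  rw [encard_coe_eq_coe_finsetCard] at hQ
  have hcard : Q.card = 2 * m + 2 + 1 := by exact_mod_cast hQ
  -- Pigeonhole: `2m + 3` points in `m + 1` half-open cells of length `ℓ` put three in one cell,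
  -- where all distances are strictly below `ℓ`.
  obtain ⟨j, -, hj⟩ := Finset.exists_lt_card_fiber_of_mul_lt_card_of_maps_to
    (s := Q) (t := Finset.range (m + 1)) (f := fun p => ⌊(θ p - x) / ℓ⌋₊) (n := 2)
    (fun p hp => by
      have h := hθ p (hQP hp)
      rw [Finset.mem_range, Nat.floor_lt (div_nonneg (by linarith [h.1]) hℓ.le),
        div_lt_iff₀ hℓ]
      push_cast
      exact h.2)
    (by rw [Finset.card_range, hcard]; omega)
  obtain ⟨p, q, r, hp, hq, hr, hpq, hpr, hqr⟩ := Finset.two_lt_card_iff.1 hj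
  simp only [Finset.mem_filter] at hp hq hr
  have hd {p q : α} (hp : p ∈ Q ∧ ⌊(θ p - x) / ℓ⌋₊ = j) (hq : q ∈ Q ∧ ⌊(θ q - x) / ℓ⌋₊ = j) :
      |θ p - θ q| < ℓ := by
    have b {p : α} (hp : p ∈ Q ∧ ⌊(θ p - x) / ℓ⌋₊ = j) :
        j * ℓ ≤ θ p - x ∧ θ p - x < (j + 1) * ℓ := by
      have := (Nat.floor_eq_iff (div_nonneg (by linarith [(hθ p (hQP hp.1)).1]) hℓ.le)).1 hp.2
      rwa [le_div_iff₀ hℓ, div_lt_iff₀ hℓ] at this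
    have h1 := b hp
    have h2 := b hq
    rw [abs_lt]
    constructor <;> linarith [h1.1, h1.2, h2.1, h2.2]
  exact h3 p (hQP hp.1) q (hQP hq.1) r (hQP hr.1) hpq hpr hqr (hd hp hq) (hd hp hr) (hd hq hr)

theorem theorem5 (C : Set Plane) (hconv : IsConvexCurve C)
    (c : ℝ → Plane) (I : Set ℝ) (hI : Bornology.IsBounded I)
    (hc : IsAffineParametrization c I C)
    (k₀ k₁ : ℝ) (hκ : ∀ s ∈ I, k₀ ≤ affineCurvature c I s ∧ affineCurvature c I s ≤ k₁)
    (v₀ v₁ v₂ : Plane) (hv : LinearIndependent ℝ ![v₁, v₂])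
    (hrange : (areaMultiplicity C v₀ v₁ v₂ : ℝ) * latticeArea v₁ v₂ / 2 ∈ areaFunRange k₀)
    (L : ℝ)
    (hL : L = areaFunInv k₀ ((areaMultiplicity C v₀ v₁ v₂ : ℝ) * latticeArea v₁ v₂ / 2))
    (m : ℕ) (hm : m = ⌊affineLength c I / (2 * L)⌋₊)
    (hk₁ : 0 < k₁ → k₁ ≤ (Real.pi / (2 * L)) ^ 2) :
    (planeLattice v₀ v₁ v₂ ∩ C).encard ≤ ((2 * m + 2 : ℕ) : ℕ∞) := by
  -- With at most two points the bound is trivial, whatever the default values of `𝔪` and `L`.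
  rcases le_or_gt (planeLattice v₀ v₁ v₂ ∩ C).encard 2 with h2 | h2
  · exact h2.trans (by exact_mod_cast Nat.le_add_left 2 (2 * m))
  obtain ⟨p, hp, q, hq, r, hr, hpq, hpr, hqr⟩ : ∃ p ∈ planeLattice v₀ v₁ v₂ ∩ C,
      ∃ q ∈ planeLattice v₀ v₁ v₂ ∩ C, ∃ r ∈ planeLattice v₀ v₁ v₂ ∩ C,
        p ≠ q ∧ p ≠ r ∧ q ≠ r := by
    obtain ⟨Q, hQP, hQ⟩ := exists_subset_encard_eq (Order.add_one_le_of_lt h2)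
    obtain ⟨p, q, r, hpq, hpr, hqr, rfl⟩ := encard_eq_three.1 (hQ.trans (by norm_num))
    exact ⟨p, hQP (by simp), q, hQP (by simp), r, hQP (by simp), hpq, hpr, hqr⟩
  obtain ⟨hM, harea⟩ := areaMultiplicity_spec hc hconv hv hp hq hr hpq hpr hqr
  have hA : 0 < latticeArea v₁ v₂ := abs_pos.2 (wedge_ne_zero_of_linearIndependent hv)
  have hLdom : L ∈ areaFunDomain k₀ := hL ▸ areaFunInv_mem hrange
  have hHL : areaFun k₀ L = areaMultiplicity C v₀ v₁ v₂ * latticeArea v₁ v₂ / 2 :=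
    hL ▸ areaFun_areaFunInv hrange
  have hLpos : 0 < L := by
    refine lt_of_le_of_ne (mem_areaFunDomain.1 hLdom).1 ?_
    rintro rfl
    rw [areaFun_zero] at hHL
    have : (0 : ℝ) < areaMultiplicity C v₀ v₁ v₂ := by exact_mod_cast hM
    have := mul_pos this hA
    linarith
  have hκ' : ∀ s ∈ I, k₀ ≤ affineCurvature c I s ∧
      affineCurvature c I s ≤ (Real.pi / (2 * L)) ^ 2 := fun s hs => by
    refine ⟨(hκ s hs).1, (hκ s hs).2.trans ?_⟩
    rcases le_or_gt k₁ 0 with h | h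
    · exact h.trans (sq_nonneg _)
    · exact hk₁ h
  -- One parameter is chosen for each point, so the coinciding end points of a closed curve need no
  -- separate treatment.
  have hθ : ∀ p ∈ C, ∃ s ∈ I, c s = p := fun p hp => by rwa [← hc.image_eq] at hp
  choose! θ hθI hθc using hθ
  refine encard_le_of_forall_not_three (θ := θ) (x := sInf I) (ℓ := 2 * L) (by positivity)
    (fun p hp => ⟨csInf_le hI.bddBelow (hθI p hp.2), ?_⟩)
    fun p hp q hq r hr hpq hpr hqr h₁ h₂ h₃ => ?_
  -- Cells are counted from `sInf I`, which need not lie in `I`. Parameters exceed it by at most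
  -- `Λ`, and `Λ < (m + 1) * 2L` because `m` is the floor.
  · have h1 : θ p - affineLength c I ≤ sInf I :=
      le_csInf (hc.interior_nonempty.mono interior_subset) fun s hs => by
        linarith [hc.sub_le_affineLength hI hs (hθI p hp.2)]
    have h2 := Nat.lt_floor_add_one (affineLength c I / (2 * L))
    rw [← hm, div_lt_iff₀ (by positivity)] at h2
    linarith
  · have h := hc.triangleArea_lt_areaFun_of_abs_lt hLpos hLdom hκ' (hθI p hp.2) (hθI q hq.2)
      (hθI r hr.2) h₁ h₂ h₃
    rw [hθc p hp.2, hθc q hq.2, hθc r hr.2, hHL] at h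
    linarith [harea p hp q hq r hr hpq hpr hqr]
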